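/- Let $X_1, X_2, \ldots$ be independent identically distributed real random variables, and let $X$ have the same distribution as each $X_n$. Let $f_1, \ldots, f_m : \mathbb R \to \mathbb R$ be (Borel measurable) functions with $\mathbb E[f_i(X)^4] < \infty$ for $i = 1, \ldots, m$. For functions $f, g : \mathbb R \to \mathbb R$ and integers $k \ge 1$, $N > k$, put $$\hat m(f) := \frac1N \sum_{i=1}^N f(X_i), \qquad \hat\gamma_k(f, g) := \frac1{N-k} \sum_{i=1}^{N-k} \bigl(f(X_i) - \hat m(f)\bigr)\bigl(g(X_{i+k}) - \hat m(g)\bigr),$$ and let $Q(f, g) := \mathrm{Cov}(f(X), g(X))$. Let $\hat{\mathbb Q}_k := [\hat\gamma_k(f_i, f_j),\ i, j = 1, \ldots, m] \in \mathbb R^{m^2}$ be the vector of empirical auto- and cross-covariances with lag $k$. Then, for every fixed $K$, as $N \to \infty$, $$N^{1/2} \bigl[\hat{\mathbb Q}_1, \ldots, \hat{\mathbb Q}_K\bigr] \Rightarrow (\Xi_1, \ldots, \Xi_K)$$ (weak convergence in $(\mathbb R^{m^2})^K$), where $\Xi_1, \ldots, \Xi_K$ are independent and identically distributed Gaussian vectors,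 $\Xi_k \sim N_{m^2}(\mathbf 0, \mathbf Q)$, with covariance matrix $$\mathbf Q_{(ij), (i'j')} := Q(f_i, f_{i'})\, Q(f_j, f_{j'}), \qquad i, j, i', j' = 1, \ldots, m.$$ Equivalently, $\mathbf Q = \mathcal Q \otimes \mathcal Q$ (Kronecker product), where $\mathcal Q := (Q(f_i, f_j))_{i,j=1,\ldots,m}$ is the covariance matrix of $(f_1(X), \ldots, f_m(X))$. In particular $\mathbf Q$ is positive semidefinite. -/

import Mathlib

open MeasureTheory ProbabilityTheory Filter
open scoped Kronecker

noncomputable section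

/-- Empirical mean `m̂(f) = (1/N) ∑_{i=1}^N f(X_i)`. Sequences are indexed from `0`:
the value `x n` is the observation `X_{n+1}`. -/
def empMean (x : ℕ → ℝ) (f : ℝ → ℝ) (N : ℕ) : ℝ :=
  (1 / (N : ℝ)) * ∑ i ∈ Finset.range N, f (x i)

/-- Empirical cross-covariance with lag `k`,
`γ̂_k(f, g) = (1/(N-k)) ∑_{i=1}^{N-k} (f(X_i) - m̂(f)) (g(X_{i+k}) - m̂(g))`,
computed from the first `N` observations (meaningful for `N > k`). -/
def empCrossCov (x : ℕ → ℝ) (f g : ℝ → ℝ) (k N : ℕ) : ℝ :=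
  (1 / ((N : ℝ) - (k : ℝ))) *
    ∑ i ∈ Finset.range (N - k), (f (x i) - empMean x f N) * (g (x (i + k)) - empMean x g N)

/-- The vector `Q̂_k = [γ̂_k(f_i, f_j), i, j = 1, …, m]` in `ℝ^{m²}`. -/
def empCrossCovVector {m : ℕ} (x : ℕ → ℝ) (f : Fin m → ℝ → ℝ) (k N : ℕ) :
    EuclideanSpace ℝ (Fin m × Fin m) :=
  WithLp.toLp 2 fun p => empCrossCov x (f p.1) (f p.2) k N

/-- The covariance matrix `(Q(f_i, f_j))` of `(f_1(X), …, f_m(X))`, where `X` has law `μ`. -/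
def covMat {m : ℕ} (μ : Measure ℝ) (f : Fin m → ℝ → ℝ) : Matrix (Fin m) (Fin m) ℝ :=
  Matrix.of fun i j => covariance (f i) (f j) μ

/-- The limiting covariance matrix, with entries
`𝐐_{(i j), (i' j')} = Q(f_i, f_{i'}) Q(f_j, f_{j'})`, where `X` has law `μ`. -/
def limitCovMat {m : ℕ} (μ : Measure ℝ) (f : Fin m → ℝ → ℝ) :
    Matrix (Fin m × Fin m) (Fin m × Fin m) ℝ :=
  Matrix.of fun p q => covariance (f p.1) (f q.1) μ * covariance (f p.2) (f q.2) μ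

end

/-!
Centring the functions does not change the empirical covariances, so let `a i = f i - E f i (X)`.
Then `√N γ̂_k(a i, a j)` differs from `N^{-1/2} ∑_{n < N} a i (X n) * a j (X (n + k))` by terms whose
`L¹` norm is `O(N^{-1/2})`, since sums of `N` centred iid variables are of order `√N` in `L²`
(`tendsto_integral_abs_sqrt_mul_empCrossCov_sub`).

By Lévy's theorem it is enough to treat a fixed linear combination of these sums over all lags and
all pairs `(i, j)`. It is a sum of variables `Y n`, each a function of the window
`(X n, …, X (n + K))`. Two lag products that differ in starting point or in lag are uncorrelated,
because one of the four indices involved occurs only once and contributes a centred factor; for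
equal starting point and lag the covariance factors as `Q(f i, f i') * Q(f j, f j')`
(`integral_mul_lag_mul_lag`). Hence the `Y n` are uncorrelated, and their variance is the sum over
the lags of the quadratic form of the limiting covariance matrix, which is the exponent of the
product Gaussian law (`charFun_pi_multivariateGaussian`).

The central limit theorem for the `Y n` (`tendsto_charFun_inv_sqrt_mul_sum_window`) follows from the
one for iid variables by the blocking method: long blocks separated by gaps of length `K` are
independent, and orthogonality makes the contribution of the gaps negligible.
-/

open scoped Topology

/-! ### Estimates in mean and mean square -/

/-- Characteristic functions are Lipschitz in the random variable for the `L¹` distance. The two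
arguments `s`, `t` may differ, so that a change of normalisation is covered as well. -/
lemma norm_charFun_map_sub_charFun_map_le {Ω : Type*} [MeasurableSpace Ω] {P : Measure Ω}
    [IsProbabilityMeasure P] {A B : Ω → ℝ} (hA : AEMeasurable A P) (hB : AEMeasurable B P)
    (s t : ℝ) (h : Integrable (fun ω => s * A ω - t * B ω) P) :
    ‖charFun (P.map A) s - charFun (P.map B) t‖ ≤ ∫ ω, |s * A ω - t * B ω| ∂P := by
  have key : ∀ x y : ℝ, ‖Complex.exp (x * Complex.I) - Complex.exp (y * Complex.I)‖ ≤ |x - y| := by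
    intro x y
    have h1 : Complex.exp (x * Complex.I) - Complex.exp (y * Complex.I)
        = Complex.exp (Complex.I * y) * (Complex.exp (Complex.I * ((x - y : ℝ) : ℂ)) - 1) := by
      rw [mul_sub, ← Complex.exp_add]; push_cast; congr 2 <;> ring_nf
    rw [h1, norm_mul, Complex.norm_exp_I_mul_ofReal, one_mul]
    exact Real.norm_exp_I_mul_ofReal_sub_one_le
  have hint : ∀ {C : Ω → ℝ}, AEMeasurable C P → ∀ r : ℝ,
      Integrable (fun ω => Complex.exp (((r * C ω : ℝ) : ℂ) * Complex.I)) P := by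
    intro C hC r
    refine Integrable.of_bound (C := 1) (by fun_prop) (ae_of_all _ fun ω => ?_)
    rw [Complex.norm_exp_ofReal_mul_I]
  have hcf : ∀ {C : Ω → ℝ}, AEMeasurable C P → ∀ r : ℝ,
      charFun (P.map C) r = ∫ ω, Complex.exp (((r * C ω : ℝ) : ℂ) * Complex.I) ∂P := by
    intro C hC r
    rw [charFun_apply_real, integral_map hC (by fun_prop)]
    push_cast; rfl
  rw [hcf hA, hcf hB, ← integral_sub (hint hA s) (hint hB t)]
  exact (norm_integral_le_integral_norm _).trans
    (integral_mono ((hint hA s).sub (hint hB t)).norm h.abs fun ω => key _ _)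

lemma integral_abs_le_sqrt_integral_sq {Ω : Type*} [MeasurableSpace Ω] {P : Measure Ω}
    [IsProbabilityMeasure P] {A : Ω → ℝ} (hA : MemLp A 2 P) :
    ∫ ω, |A ω| ∂P ≤ √(∫ ω, A ω ^ 2 ∂P) := by
  refine Real.le_sqrt_of_sq_le ?_
  have h := variance_nonneg |A| P
  rw [variance_eq_sub hA.abs] at h
  simpa using h

lemma integral_sq_sum_of_orthogonal {Ω ι : Type*} [MeasurableSpace Ω] {P : Measure Ω}
    {Y : ι → Ω → ℝ} {v : ℝ} (hY : ∀ n, MemLp (Y n) 2 P)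
    (horth : ∀ n n', n ≠ n' → ∫ ω, Y n ω * Y n' ω ∂P = 0)
    (hv : ∀ n, ∫ ω, Y n ω ^ 2 ∂P = v) (D : Finset ι) :
    ∫ ω, (∑ n ∈ D, Y n ω) ^ 2 ∂P = D.card * v := by
  classical
  simp_rw [sq, Finset.sum_mul_sum]
  have hi : ∀ n n', Integrable (fun ω => Y n ω * Y n' ω) P :=
    fun n n' => (hY n).integrable_mul (hY n')
  rw [integral_finsetSum _ fun n _ => integrable_finsetSum _ fun n' _ => hi n n']
  simp_rw [integral_finsetSum _ fun n' _ => hi _ n']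
  rw [Finset.sum_congr rfl (g := fun _ => v), Finset.sum_const, nsmul_eq_mul]
  intro n hn
  rw [Finset.sum_eq_single_of_mem n hn fun n' _ hne => horth n n' hne.symm, ← hv n]
  simp_rw [sq]

/-! ### Independence of blocks -/

section Blocks

variable {Ω E : Type*} [MeasurableSpace Ω] [MeasurableSpace E] {P : Measure Ω}
  {X : ℕ → Ω → E}

/-- The rows of a doubly indexed independent family are independent: a converse to
`iIndepFun_uncurry'`. -/
lemma ProbabilityTheory.iIndepFun.curry {ι κ : Type*} {Z : ι × κ → Ω → E}
    (hZ : ∀ p, Measurable (Z p)) (h : iIndepFun Z P) :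
    iIndepFun (fun i ω (j : κ) => Z (i, j) ω) P := by
  have := h.isProbabilityMeasure
  have hp : ∀ p, IsProbabilityMeasure (P.map (Z p)) :=
    fun p => Measure.isProbabilityMeasure_map (hZ p).aemeasurable
  have h' : ∀ i, iIndepFun (fun j => Z (i, j)) P := fun i =>
    h.precomp (g := fun j => (i, j)) (fun a b hab => by simpa using hab)
  rw [iIndepFun_iff_map_fun_eq_infinitePi_map (by fun_prop)]
  have h1 := (iIndepFun_iff_map_fun_eq_infinitePi_map hZ).1 h
  have h2 : ∀ i, P.map (fun ω (j : κ) => Z (i, j) ω)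
      = Measure.infinitePi (fun j => P.map (Z (i, j))) :=
    fun i => (iIndepFun_iff_map_fun_eq_infinitePi_map (fun j => hZ (i, j))).1 (h' i)
  simp_rw [h2]
  rw [← Measure.infinitePi_map_curry (fun i j => P.map (Z (i, j))), ← h1,
    Measure.map_map (by fun_prop) (by fun_prop)]
  rfl

lemma iIndepFun_blocks (hX : ∀ n, Measurable (X n)) (h : iIndepFun X P) (L : ℕ) :
    iIndepFun (fun (b : ℕ) ω (j : Fin L) => X (b * L + j) ω) P := by
  refine iIndepFun.curry (Z := fun p : ℕ × Fin L => X (p.1 * L + p.2)) (fun p => hX _)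
    (h.precomp (g := fun p : ℕ × Fin L => p.1 * L + p.2) ?_)
  rintro ⟨b, j⟩ ⟨b', j'⟩ hbj
  have hL : 0 < L := j.pos
  have h1 := congrArg (· / L) hbj
  have h2 := congrArg (· % L) hbj
  simp only [Nat.mul_add_mod_self_right, Nat.mod_eq_of_lt j.2, Nat.mod_eq_of_lt j'.2] at h2
  simp only [Nat.add_comm (_ * L), Nat.add_mul_div_right _ _ hL, Nat.div_eq_of_lt j.2,
    Nat.div_eq_of_lt j'.2, zero_add] at h1
  exact Prod.ext h1 (Fin.ext h2)

lemma identDistrib_window (hX : ∀ n, Measurable (X n)) (h : iIndepFun X P)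
    (hid : ∀ n, P.map (X n) = P.map (X 0)) (L n n' : ℕ) :
    IdentDistrib (fun ω (j : Fin L) => X (n + j) ω) (fun ω (j : Fin L) => X (n' + j) ω) P P where
  aemeasurable_fst := by fun_prop
  aemeasurable_snd := by fun_prop
  map_eq := by
    have key : ∀ n, P.map (fun ω (j : Fin L) => X (n + j) ω) = Measure.pi fun _ => P.map (X 0) := by
      intro n
      have h' : iIndepFun (fun j : Fin L => X (n + j)) P :=
        h.precomp (g := fun j : Fin L => n + (j : ℕ)) fun a b hab => Fin.ext (by simpa using hab)
      rw [h'.map_fun_eq_pi_map fun j => (hX _).aemeasurable]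
      simp_rw [hid]
    rw [key, key]

end Blocks

/-! ### A central limit theorem for sliding windows -/

/-- The first `ℓ` indices of each of the `N / L` complete blocks of length `L` in `range N` form a
set `D` of `N / L * ℓ` indices, over which one may sum block by block. -/
lemma exists_finset_sum_blocks {ℓ L : ℕ} (hℓ : ℓ ≤ L) (hL : 0 < L) (N : ℕ) :
    ∃ D ⊆ Finset.range N, D.card = N / L * ℓ ∧ ∀ Y : ℕ → ℝ,
      ∑ b ∈ Finset.range (N / L), ∑ r : Fin ℓ, Y (b * L + r) = ∑ n ∈ D, Y n := by
  have hinj : Set.InjOn (fun p : ℕ × ℕ => p.1 * L + p.2)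
      (Finset.range (N / L) ×ˢ Finset.range ℓ : Finset (ℕ × ℕ)) := by
    rintro ⟨b, r⟩ hb ⟨b', r'⟩ hb' h
    simp only [Finset.coe_product, Set.mem_prod, Finset.coe_range, Set.mem_Iio] at hb hb'
    have hr := hb.2.trans_le hℓ
    have hr' := hb'.2.trans_le hℓ
    have h1 := congrArg (· / L) h
    have h2 := congrArg (· % L) h
    simp only [Nat.mul_add_mod_self_right, Nat.mod_eq_of_lt hr, Nat.mod_eq_of_lt hr'] at h2
    simp only [Nat.add_comm (_ * L), Nat.add_mul_div_right _ _ hL, Nat.div_eq_of_lt hr,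
      Nat.div_eq_of_lt hr', zero_add] at h1
    exact Prod.ext h1 h2
  refine ⟨(Finset.range (N / L) ×ˢ Finset.range ℓ).image fun p => p.1 * L + p.2, ?_, ?_, ?_⟩
  · intro n hn
    simp only [Finset.mem_image, Finset.mem_product, Finset.mem_range, Prod.exists] at hn ⊢
    obtain ⟨b, r, ⟨hb, hr⟩, rfl⟩ := hn
    calc b * L + r < b * L + L := by omega
      _ = (b + 1) * L := by ring
      _ ≤ N / L * L := Nat.mul_le_mul_right _ hb
      _ ≤ N := Nat.div_mul_le_self _ _
  · rw [Finset.card_image_of_injOn hinj]; simp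
  · intro Y
    rw [Finset.sum_image hinj, Finset.sum_product]
    exact Finset.sum_congr rfl fun b _ => Fin.sum_univ_eq_sum_range (fun r => Y (b * L + r)) ℓ

lemma tendsto_natDiv_div_atTop {L : ℕ} (hL : 0 < L) :
    Tendsto (fun N : ℕ => ((N / L : ℕ) : ℝ) / N) atTop (𝓝 (1 / L : ℝ)) := by
  have hL' : (0 : ℝ) < L := by exact_mod_cast hL
  refine tendsto_of_tendsto_of_tendsto_of_le_of_le' (g := fun N : ℕ => (1 / L : ℝ) - 1 / N)
    (h := fun _ => (1 / L : ℝ)) ?_ tendsto_const_nhds ?_ ?_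
  · simpa using tendsto_const_nhds.sub (tendsto_one_div_atTop_nhds_zero_nat (𝕜 := ℝ))
  · filter_upwards [eventually_gt_atTop 0] with N hN
    have hN' : (0 : ℝ) < N := by exact_mod_cast hN
    have h : (N : ℝ) ≤ ((N / L : ℕ) : ℝ) * L + L := by
      exact_mod_cast (Nat.lt_div_mul_add hL).le
    rw [div_sub_div _ _ hL'.ne' hN'.ne', div_le_div_iff₀ (by positivity) hN']
    nlinarith
  · filter_upwards [eventually_gt_atTop 0] with N hN
    have hN' : (0 : ℝ) < N := by exact_mod_cast hN
    have h : ((N / L : ℕ) : ℝ) * L ≤ N := by exact_mod_cast Nat.div_mul_le_self N L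
    rw [div_le_div_iff₀ hN' hL']
    linarith

/-- The central limit theorem for centred iid variables in terms of characteristic functions,
including the degenerate case of variance zero. -/
lemma tendsto_charFun_inv_sqrt_mul_sum {Ω : Type*} [MeasurableSpace Ω] {P : Measure Ω}
    [IsProbabilityMeasure P] {U : ℕ → Ω → ℝ} (hU : MemLp (U 0) 2 P) (h0 : ∫ ω, U 0 ω ∂P = 0)
    (hindep : iIndepFun U P) (hid : ∀ n, IdentDistrib (U n) (U 0) P P) (s : ℝ) :
    Tendsto (fun q : ℕ =>
        charFun (P.map fun ω => (√(q : ℝ))⁻¹ * ∑ b ∈ Finset.range q, U b ω) s) atTop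
      (𝓝 (Complex.exp ((-(s ^ 2 * ∫ ω, U 0 ω ^ 2 ∂P) / 2 : ℝ) : ℂ))) := by
  have h := tendstoInDistribution_inv_sqrt_mul_sum_sub
    (Y := id) (P' := gaussianReal 0 Var[U 0; P].toNNReal) HasLaw.id hU hindep hid
  have h1 := ProbabilityMeasure.tendsto_iff_tendsto_charFun.1 h.tendsto s
  simp only [ProbabilityMeasure.coe_mk, Measure.map_id, charFun_gaussianReal, h0, mul_zero,
    sub_zero] at h1
  convert h1 using 2
  have hv : Var[U 0; P] = ∫ ω, U 0 ω ^ 2 ∂P := by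
    rw [variance_of_integral_eq_zero hU.aemeasurable h0]
  rw [Real.coe_toNNReal _ (variance_nonneg _ _), hv]
  push_cast
  congr 1
  simp only [mul_zero, zero_mul, zero_sub]
  ring

/-- Central limit theorem for functionals `Y n = y (X n, …, X (n + K))` of a sliding window over an
iid sequence, when the `Y n` are centred and pairwise uncorrelated with common second moment `v`.
For a block length `ℓ`, the sums over `ℓ` consecutive indices separated by gaps of length `K` are
iid and obey the classical theorem; by orthogonality the gaps carry only a proportion `K / (ℓ + K)`
of the second moment, which disappears as `ℓ → ∞`. -/
theorem tendsto_charFun_inv_sqrt_mul_sum_window {Ω E : Type*} [MeasurableSpace Ω]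
    [MeasurableSpace E] {P : Measure Ω} [IsProbabilityMeasure P] {X : ℕ → Ω → E}
    (hX : ∀ n, Measurable (X n)) (hindep : iIndepFun X P)
    (hid : ∀ n, P.map (X n) = P.map (X 0)) {K : ℕ} {y : (Fin (K + 1) → E) → ℝ}
    (hy : Measurable y) {Y : ℕ → Ω → ℝ} (hYdef : ∀ n ω, Y n ω = y fun j => X (n + j) ω)
    (hY2 : ∀ n, MemLp (Y n) 2 P) (hY0 : ∀ n, ∫ ω, Y n ω ∂P = 0) {v : ℝ}
    (horth : ∀ n n', n ≠ n' → ∫ ω, Y n ω * Y n' ω ∂P = 0)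
    (hv : ∀ n, ∫ ω, Y n ω ^ 2 ∂P = v) (s : ℝ) :
    Tendsto (fun N : ℕ =>
        charFun (P.map fun ω => (√(N : ℝ))⁻¹ * ∑ n ∈ Finset.range N, Y n ω) s) atTop
      (𝓝 (Complex.exp ((-(s ^ 2 * v) / 2 : ℝ) : ℂ))) := by
  -- Block sums: `ℓ` consecutive summands out of every `ℓ + K`.
  let U : ℕ → ℕ → Ω → ℝ := fun ℓ b ω => ∑ r : Fin ℓ, Y (b * (ℓ + K) + r) ω
  let φ : (ℓ : ℕ) → (Fin (ℓ + K) → E) → ℝ := fun ℓ w =>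
    ∑ r : Fin ℓ, y fun j : Fin (K + 1) => w ⟨r + j, by omega⟩
  have hφ : ∀ ℓ, Measurable (φ ℓ) := fun ℓ => by
    refine Finset.measurable_sum _ fun r _ => hy.comp ?_
    fun_prop
  have hUφ : ∀ ℓ b, U ℓ b = φ ℓ ∘ fun ω (j : Fin (ℓ + K)) => X (b * (ℓ + K) + j) ω := by
    intro ℓ b
    ext ω
    simp only [U, φ, Function.comp, hYdef, add_assoc]
  have hUindep : ∀ ℓ, iIndepFun (U ℓ) P := by
    intro ℓ
    have h := (iIndepFun_blocks hX hindep (ℓ + K)).comp (fun _ => φ ℓ) fun _ => hφ ℓ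
    have : U ℓ = fun b => φ ℓ ∘ fun ω (j : Fin (ℓ + K)) => X (b * (ℓ + K) + j) ω :=
      funext (hUφ ℓ)
    rwa [this]
  have hUid : ∀ ℓ b, IdentDistrib (U ℓ b) (U ℓ 0) P P := by
    intro ℓ b
    rw [hUφ, hUφ]
    exact (identDistrib_window hX hindep hid (ℓ + K) _ _).comp (hφ ℓ)
  have hU2 : ∀ ℓ b, MemLp (U ℓ b) 2 P := fun ℓ b => memLp_finsetSum _ fun r _ => hY2 _
  have hU0 : ∀ ℓ b, ∫ ω, U ℓ b ω ∂P = 0 := fun ℓ b => by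
    simp only [U]
    rw [integral_finsetSum _ fun r _ => (hY2 _).integrable (by norm_num)]
    simp [hY0]
  have hUv : ∀ ℓ, ∫ ω, U ℓ 0 ω ^ 2 ∂P = ℓ * v := fun ℓ => by
    have h := integral_sq_sum_of_orthogonal hY2 horth hv (Finset.range ℓ)
    rw [Finset.card_range] at h
    rw [← h]
    congr with ω
    simp only [U, zero_mul, zero_add]
    rw [Fin.sum_univ_eq_sum_range (fun r => Y r ω) ℓ]
  -- The characteristic functions of the normalised block sums.
  let S : ℕ → Ω → ℝ := fun N ω => (√(N : ℝ))⁻¹ * ∑ n ∈ Finset.range N, Y n ω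
  let G : ℕ → ℕ → Ω → ℝ := fun ℓ q ω => (√(q : ℝ))⁻¹ * ∑ b ∈ Finset.range q, U ℓ b ω
  let g : ℕ → ℂ := fun ℓ =>
    Complex.exp ((-((s / √((ℓ + K : ℕ) : ℝ)) ^ 2 * (ℓ * v)) / 2 : ℝ) : ℂ)
  have hGlim : ∀ ℓ, Tendsto (fun q => charFun (P.map (G ℓ q)) (s / √((ℓ + K : ℕ) : ℝ))) atTop
      (𝓝 (g ℓ)) := by
    intro ℓ
    have h := tendsto_charFun_inv_sqrt_mul_sum (hU2 ℓ 0) (hU0 ℓ 0) (hUindep ℓ) (hUid ℓ)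
      (s / √((ℓ + K : ℕ) : ℝ))
    rwa [hUv] at h
  have hS2 : ∀ N, MemLp (S N) 2 P := fun N =>
    (memLp_finsetSum _ fun n _ => hY2 n).const_mul _
  have hG2 : ∀ ℓ q, MemLp (G ℓ q) 2 P := fun ℓ q =>
    (memLp_finsetSum _ fun n _ => hU2 ℓ n).const_mul _
  -- The error made by discarding the summands outside the blocks.
  let e : ℕ → ℝ → ℝ := fun ℓ r =>
    |s| * (√((1 - r * ℓ) * v) + |√r - √(1 / (ℓ + K : ℕ))| * √(ℓ * v))
  have hbound : ∀ ℓ, 0 < ℓ → ∀ N, ℓ + K ≤ N →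
      ‖charFun (P.map (S N)) s - charFun (P.map (G ℓ (N / (ℓ + K)))) (s / √((ℓ + K : ℕ) : ℝ))‖
        ≤ e ℓ (((N / (ℓ + K) : ℕ) : ℝ) / N) := by
    intro ℓ hℓ N hN
    set L := ℓ + K with hLdef
    set q := N / L with hq
    have hL : 0 < L := by omega
    have hqpos : 0 < q := Nat.div_pos hN hL
    have hL' : (0 : ℝ) < L := by exact_mod_cast hL
    have hq' : (0 : ℝ) < q := by exact_mod_cast hqpos
    have hN' : (0 : ℝ) < N := by exact_mod_cast hL.trans_le hN
    obtain ⟨D, hDsub, hDcard, hDsum⟩ := exists_finset_sum_blocks (ℓ := ℓ) (by omega) hL N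
    let R : Finset ℕ := Finset.range N \ D
    have hRcard : (R.card : ℝ) = N - q * ℓ := by
      have h := Finset.card_sdiff_add_card_eq_card hDsub
      rw [Finset.card_range, hDcard] at h
      have : (R.card : ℝ) + q * ℓ = N := by exact_mod_cast h
      linarith
    have hsplit : ∀ ω, ∑ n ∈ Finset.range N, Y n ω
        = ∑ n ∈ R, Y n ω + ∑ n ∈ D, Y n ω :=
      fun ω => (Finset.sum_sdiff hDsub).symm
    have hUD : ∀ ω, ∑ b ∈ Finset.range q, U ℓ b ω = ∑ n ∈ D, Y n ω :=
      fun ω => hDsum fun n => Y n ω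
    let A : Ω → ℝ := fun ω => (√(N : ℝ))⁻¹ * ∑ n ∈ R, Y n ω
    let B : Ω → ℝ := fun ω => (√(q : ℝ))⁻¹ * ∑ n ∈ D, Y n ω
    have hA2 : MemLp A 2 P := (memLp_finsetSum _ fun n _ => hY2 n).const_mul _
    have hB2 : MemLp B 2 P := (memLp_finsetSum _ fun n _ => hY2 n).const_mul _
    have hdecomp : ∀ ω, s * S N ω - s / √(L : ℝ) * G ℓ q ω
        = s * (A ω + (√((q : ℝ) / N) - √(1 / L)) * B ω) := by
      intro ω
      simp only [S, G, A, B, hsplit, hUD]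
      rw [Real.sqrt_div hq'.le, Real.sqrt_div zero_le_one, Real.sqrt_one]
      have := Real.sqrt_pos.2 hq'
      have := Real.sqrt_pos.2 hN'
      have := Real.sqrt_pos.2 hL'
      field_simp
      ring
    have hA : ∫ ω, |A ω| ∂P ≤ √((1 - (q : ℝ) / N * ℓ) * v) := by
      refine (integral_abs_le_sqrt_integral_sq hA2).trans_eq ?_
      congr 1
      simp only [A, mul_pow]
      rw [integral_const_mul, integral_sq_sum_of_orthogonal hY2 horth hv, hRcard, inv_pow,
        Real.sq_sqrt hN'.le]
      field_simp
    have hB : ∫ ω, |B ω| ∂P ≤ √(ℓ * v) := by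
      refine (integral_abs_le_sqrt_integral_sq hB2).trans_eq ?_
      congr 1
      simp only [B, mul_pow]
      rw [integral_const_mul, integral_sq_sum_of_orthogonal hY2 horth hv, hDcard, ← hq, inv_pow,
        Real.sq_sqrt hq'.le]
      push_cast
      field_simp
    have hAi := hA2.integrable (q := 2) (by norm_num)
    have hBi := hB2.integrable (q := 2) (by norm_num)
    refine (norm_charFun_map_sub_charFun_map_le (hS2 N).aemeasurable (hG2 ℓ q).aemeasurable _ _
      (((hS2 N).integrable (by norm_num)).const_mul _ |>.sub
        (((hG2 ℓ q).integrable (by norm_num)).const_mul _))).trans ?_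
    simp_rw [hdecomp, abs_mul]
    rw [integral_const_mul]
    refine mul_le_mul_of_nonneg_left ?_ (abs_nonneg s)
    set c := √((q : ℝ) / N) - √(1 / L)
    calc ∫ ω, |A ω + c * B ω| ∂P ≤ ∫ ω, (|A ω| + |c| * |B ω|) ∂P := by
          refine integral_mono (hAi.add (hBi.const_mul _)).abs
            (hAi.abs.add (hBi.abs.const_mul _)) fun ω => ?_
          simpa [abs_mul] using abs_add_le (A ω) (c * B ω)
      _ = ∫ ω, |A ω| ∂P + |c| * ∫ ω, |B ω| ∂P := by
          rw [integral_add hAi.abs (hBi.abs.const_mul _), integral_const_mul]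
      _ ≤ _ := by gcongr
  have he : ∀ ℓ, 0 < ℓ → Tendsto (fun N : ℕ => e ℓ (((N / (ℓ + K) : ℕ) : ℝ) / N)) atTop
      (𝓝 (|s| * √((1 - 1 / (ℓ + K : ℕ) * ℓ) * v))) := by
    intro ℓ hℓ
    have hcont : Continuous (e ℓ) := by fun_prop
    have h := (hcont.tendsto _).comp (tendsto_natDiv_div_atTop (L := ℓ + K) (by omega))
    have h0 : e ℓ (1 / (ℓ + K : ℕ)) = |s| * √((1 - 1 / (ℓ + K : ℕ) * ℓ) * v) := by simp [e]
    rwa [h0] at h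
  -- As the block length grows, both the discarded part and the defect in the variance vanish.
  have hratio : Tendsto (fun ℓ : ℕ => (1 / (ℓ + K : ℕ) * ℓ : ℝ)) atTop (𝓝 1) := by
    have h := tendsto_natCast_div_add_atTop (K : ℝ)
    refine h.congr fun ℓ => ?_
    push_cast
    ring
  have h1 : Tendsto (fun ℓ : ℕ => |s| * √((1 - 1 / (ℓ + K : ℕ) * ℓ) * v)) atTop (𝓝 0) := by
    have hcont : Continuous fun r : ℝ => |s| * √((1 - r) * v) := by fun_prop
    have h := (hcont.tendsto 1).comp hratio
    rwa [sub_self, zero_mul, Real.sqrt_zero, mul_zero] at h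
  have h2 : Tendsto g atTop (𝓝 (Complex.exp ((-(s ^ 2 * v) / 2 : ℝ) : ℂ))) := by
    have hcont : Continuous fun r : ℝ => Complex.exp ((-(s ^ 2 * (r * v)) / 2 : ℝ) : ℂ) := by
      fun_prop
    have h := (hcont.tendsto 1).comp hratio
    rw [one_mul] at h
    refine h.congr fun ℓ => ?_
    simp only [Function.comp, g, div_pow]
    rw [Real.sq_sqrt (Nat.cast_nonneg _)]
    congr 2
    ring
  rw [Metric.tendsto_nhds]
  intro ε hε
  obtain ⟨ℓ, hℓ, hℓ1, hℓ2⟩ := ((eventually_gt_atTop 0).and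
    ((h1.eventually_lt_const (show (0 : ℝ) < ε / 3 by positivity)).and
      ((Metric.tendsto_nhds.1 h2) (ε / 3) (by positivity)))).exists
  have hdiv : Tendsto (fun N : ℕ => N / (ℓ + K)) atTop atTop :=
    Nat.tendsto_div_const_atTop (by omega)
  filter_upwards [(he ℓ hℓ).eventually_lt_const hℓ1, eventually_ge_atTop (ℓ + K),
    Metric.tendsto_nhds.1 ((hGlim ℓ).comp hdiv) (ε / 3) (by positivity)] with N hN1 hN2 hN3
  have hN4 := (hbound ℓ hℓ N hN2).trans_lt hN1
  rw [← dist_eq_norm] at hN4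
  calc dist (charFun (P.map (S N)) s) _
      ≤ _ := dist_triangle4 _ _ _ _
    _ < ε / 3 + ε / 3 + ε / 3 := add_lt_add (add_lt_add hN4 hN3) hℓ2
    _ = ε := by ring

/-! ### Second moments of lag products -/

lemma ProbabilityTheory.HasLaw.memLp_comp {Ω : Type*} [MeasurableSpace Ω] {P : Measure Ω}
    {μ : Measure ℝ} {Z : Ω → ℝ} (hZ : HasLaw Z μ P) {u : ℝ → ℝ} {p : ENNReal} (hu : MemLp u p μ) :
    MemLp (fun ω => u (Z ω)) p P := by
  rw [← hZ.map_eq] at hu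
  exact hu.comp_of_map hZ.aemeasurable

section Moments

variable {Ω : Type*} [MeasurableSpace Ω] {P : Measure Ω} {μ : Measure ℝ} {X : ℕ → Ω → ℝ}

lemma integral_mul_comp_of_notMem (hX : ∀ n, Measurable (X n)) (hindep : iIndepFun X P)
    {u v w z : ℝ → ℝ} (hu : Measurable u) (hv : Measurable v) (hw : Measurable w)
    (hz : Measurable z) {p q r s : ℕ} (hq : p ≠ q) (hr : p ≠ r) (hs : p ≠ s) :
    ∫ ω, u (X p ω) * (v (X q ω) * (w (X r ω) * z (X s ω))) ∂P
      = (∫ ω, u (X p ω) ∂P) * ∫ ω, v (X q ω) * (w (X r ω) * z (X s ω)) ∂P := by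
  have h := hindep.indepFun_finset {p} {q, r, s} (by simp [hq, hr, hs]) hX
  have h2 : IndepFun (fun ω => u (X p ω)) (fun ω => v (X q ω) * (w (X r ω) * z (X s ω))) P :=
    h.comp (φ := fun x : ({p} : Finset ℕ) → ℝ => u (x ⟨p, by simp⟩))
      (ψ := fun x : ({q, r, s} : Finset ℕ) → ℝ =>
        v (x ⟨q, by simp⟩) * (w (x ⟨r, by simp⟩) * z (x ⟨s, by simp⟩)))
      (by fun_prop) (by fun_prop)
  refine h2.integral_fun_mul_eq_mul_integral ?_ ?_
  · exact (hu.comp (hX p)).aestronglyMeasurable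
  · have := hX q; have := hX r; have := hX s
    exact Measurable.aestronglyMeasurable (by fun_prop)

/-- Products `a (X n) * b (X (n + k + 1))` with different starting points or different lags are
uncorrelated, and their covariances at equal `n` and `k` factor. The lag is written `k + 1` because
positivity is what makes the two factors of each product independent. -/
lemma integral_mul_lag_mul_lag (hX : ∀ n, Measurable (X n)) (hindep : iIndepFun X P)
    (hlaw : ∀ n, HasLaw (X n) μ P) {a b a' b' : ℝ → ℝ} (ha : Measurable a) (hb : Measurable b)
    (ha' : Measurable a') (hb' : Measurable b') (ha0 : ∫ x, a x ∂μ = 0) (hb0 : ∫ x, b x ∂μ = 0)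
    (ha0' : ∫ x, a' x ∂μ = 0) (hb0' : ∫ x, b' x ∂μ = 0) (n n' k k' : ℕ) :
    ∫ ω, (a (X n ω) * b (X (n + (k + 1)) ω)) * (a' (X n' ω) * b' (X (n' + (k' + 1)) ω)) ∂P
      = if n = n' ∧ k = k' then (∫ x, a x * a' x ∂μ) * ∫ x, b x * b' x ∂μ else 0 := by
  have hE : ∀ {u : ℝ → ℝ}, Measurable u → ∀ n, ∫ ω, u (X n ω) ∂P = ∫ x, u x ∂μ :=
    fun hu n => (hlaw n).integral_comp hu.aestronglyMeasurable
  have hz : ∀ {u v w z : ℝ → ℝ}, Measurable u → Measurable v → Measurable w → Measurable z →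
      ∫ x, u x ∂μ = 0 → ∀ {p q r s : ℕ}, p ≠ q → p ≠ r → p ≠ s →
      ∫ ω, u (X p ω) * (v (X q ω) * (w (X r ω) * z (X s ω))) ∂P = 0 := by
    intro u v w z hu hv hw hz hu0 p q r s hq hr hs
    rw [integral_mul_comp_of_notMem hX hindep hu hv hw hz hq hr hs, hE hu, hu0, zero_mul]
  split_ifs with h
  · obtain ⟨rfl, rfl⟩ := h
    have hi : IndepFun (fun ω => a (X n ω) * a' (X n ω))
        (fun ω => b (X (n + (k + 1)) ω) * b' (X (n + (k + 1)) ω)) P :=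
      (hindep.indepFun (show n ≠ n + (k + 1) by omega)).comp
        (φ := fun x => a x * a' x) (ψ := fun x => b x * b' x) (by fun_prop) (by fun_prop)
    have h1 := hi.integral_fun_mul_eq_mul_integral
      (((ha.mul ha').comp (hX _)).aestronglyMeasurable)
      (((hb.mul hb').comp (hX _)).aestronglyMeasurable)
    rw [hE (u := fun x => a x * a' x) (ha.mul ha'),
      hE (u := fun x => b x * b' x) (hb.mul hb')] at h1
    rw [← h1]
    congr with ω
    ring
  · -- Some index occurs exactly once among the four: the largest one if the right ends
    -- differ, the smallest one otherwise.
    rcases lt_trichotomy (n + (k + 1)) (n' + (k' + 1)) with hlt | heq | hgt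
    · rw [← hz hb' ha hb ha' hb0' (p := n' + (k' + 1)) (q := n) (r := n + (k + 1)) (s := n')
        (by omega) (by omega) (by omega)]
      congr with ω
      ring
    · rcases lt_trichotomy n n' with hlt | heq' | hgt
      · rw [← hz ha hb ha' hb' ha0 (p := n) (q := n + (k + 1)) (r := n') (s := n' + (k' + 1))
          (by omega) (by omega) (by omega)]
        congr with ω
        ring
      · exact absurd ⟨heq', by omega⟩ h
      · rw [← hz ha' ha hb hb' ha0' (p := n') (q := n) (r := n + (k + 1)) (s := n' + (k' + 1))
          (by omega) (by omega) (by omega)]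
        congr with ω
        ring
    · rw [← hz hb ha ha' hb' hb0 (p := n + (k + 1)) (q := n) (r := n') (s := n' + (k' + 1))
        (by omega) (by omega) (by omega)]
      congr with ω
      ring

lemma memLp_mul_lag (hlaw : ∀ n, HasLaw (X n) μ P) {a b : ℝ → ℝ} (ha : MemLp a 4 μ)
    (hb : MemLp b 4 μ) (n n' : ℕ) : MemLp (fun ω => a (X n ω) * b (X n' ω)) 2 P := by
  have : ENNReal.HolderTriple 4 4 2 := ⟨by
    rw [← two_mul, show (4 : ENNReal) = 2 * 2 by norm_num,
      ENNReal.mul_inv (by simp) (by simp), ← mul_assoc, ENNReal.mul_inv_cancel (by simp) (by simp),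
      one_mul]⟩
  exact ((hlaw n').memLp_comp hb).mul ((hlaw n).memLp_comp ha)

end Moments

/-! ### The effect of empirical centring -/

lemma abs_mul_le_half_add_sq (x y : ℝ) : |x * y| ≤ (x ^ 2 + y ^ 2) / 2 := by
  rw [abs_le]
  constructor <;> nlinarith [sq_nonneg (x - y), sq_nonneg (x + y)]

section Centring

lemma empMean_sub_const (x : ℕ → ℝ) (f : ℝ → ℝ) (c : ℝ) {N : ℕ} (hN : N ≠ 0) :
    empMean x (fun y => f y - c) N = empMean x f N - c := by
  have : (N : ℝ) ≠ 0 := by exact_mod_cast hN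
  simp only [empMean, Finset.sum_sub_distrib, Finset.sum_const, Finset.card_range, nsmul_eq_mul]
  field_simp

lemma empCrossCov_sub_const (x : ℕ → ℝ) (f g : ℝ → ℝ) (c d : ℝ) (k : ℕ) {N : ℕ} (hN : N ≠ 0) :
    empCrossCov x (fun y => f y - c) (fun y => g y - d) k N = empCrossCov x f g k N := by
  simp [empCrossCov, empMean_sub_const x _ _ hN]

/-- Pathwise comparison of `√N γ̂_k(a, b)` with the normalised sum of lag products: the error
consists of the change of prefactor from `1 / (N - k)` to `1 / N`, the last `k` products, and the
products of sums due to the empirical centring. Under the condition `2 * k ≤ N`,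
`1 / (N - k) ≤ 2 / N`. -/
lemma abs_sqrt_mul_empCrossCov_sub_le (x : ℕ → ℝ) (a b : ℝ → ℝ) {k N : ℕ} (hN : 2 * k ≤ N)
    (hN0 : 0 < N) :
    |√(N : ℝ) * empCrossCov x a b k N
        - (√(N : ℝ))⁻¹ * ∑ i ∈ Finset.range N, a (x i) * b (x (i + k))|
      ≤ (√(N : ℝ))⁻¹ * (
        2 * k / N * ∑ i ∈ Finset.range (N - k), |a (x i) * b (x (i + k))|
        + ∑ i ∈ Finset.Ico (N - k) N, |a (x i) * b (x (i + k))|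
        + (2 * (∑ i ∈ Finset.range N, a (x i)) ^ 2 + 2 * (∑ i ∈ Finset.range N, b (x i)) ^ 2
          + (∑ i ∈ Finset.range (N - k), a (x i)) ^ 2
          + (∑ i ∈ Finset.range (N - k), b (x (i + k))) ^ 2) / N) := by
  have hn : (0 : ℝ) < N := by exact_mod_cast hN0
  have hk : (k : ℝ) * 2 ≤ N := by exact_mod_cast (by omega : k * 2 ≤ N)
  have hk0 : (0 : ℝ) ≤ k := Nat.cast_nonneg k
  have hnk : (0 : ℝ) < N - k := by linarith
  have hcast : ((N - k : ℕ) : ℝ) = N - k := Nat.cast_sub (by omega)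
  have hs : √(N : ℝ) = (√(N : ℝ))⁻¹ * N := by
    have := Real.sqrt_pos.2 hn
    field_simp
    exact Real.sq_sqrt hn.le
  set A := ∑ i ∈ Finset.range N, a (x i) with hA
  set B := ∑ i ∈ Finset.range N, b (x i) with hB
  set A' := ∑ i ∈ Finset.range (N - k), a (x i) with hA'
  set B' := ∑ i ∈ Finset.range (N - k), b (x (i + k)) with hB'
  set M := ∑ i ∈ Finset.range (N - k), a (x i) * b (x (i + k)) with hM
  set T := ∑ i ∈ Finset.Ico (N - k) N, a (x i) * b (x (i + k)) with hT
  have hsplit : ∑ i ∈ Finset.range N, a (x i) * b (x (i + k)) = M + T :=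
    (Finset.sum_range_add_sum_Ico _ (Nat.sub_le N k)).symm
  have hcov : empCrossCov x a b k N
      = 1 / (N - k) * (M - A / N * B' - B / N * A' + (N - k) * (A / N * (B / N))) := by
    have hma : empMean x a N = A / N := by rw [empMean, ← hA]; ring
    have hmb : empMean x b N = B / N := by rw [empMean, ← hB]; ring
    rw [empCrossCov, hma, hmb]
    congr 1
    have : ∀ i, (a (x i) - A / N) * (b (x (i + k)) - B / N) = a (x i) * b (x (i + k))
        - A / N * b (x (i + k)) - B / N * a (x i) + A / N * (B / N) := fun i => by ring
    simp_rw [this]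
    rw [Finset.sum_add_distrib, Finset.sum_sub_distrib, Finset.sum_sub_distrib,
      ← Finset.mul_sum, ← Finset.mul_sum, Finset.sum_const, Finset.card_range, nsmul_eq_mul,
      hcast]
  have hexp : √(N : ℝ) * empCrossCov x a b k N - (√(N : ℝ))⁻¹ * (M + T)
      = (√(N : ℝ))⁻¹ * (k / (N - k) * M - T
        + (1 / (N - k) * (-(A * B') - B * A') + A * B / N)) := by
    rw [hcov]
    nth_rewrite 1 [hs]
    field_simp
    ring
  rw [hsplit, hexp, abs_mul, abs_of_nonneg (by positivity)]
  refine mul_le_mul_of_nonneg_left ?_ (by positivity)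
  have hinv : 1 / ((N : ℝ) - k) ≤ 2 / N := by
    rw [div_le_div_iff₀ hnk hn]; linarith
  have hkinv : (k : ℝ) / (N - k) ≤ 2 * k / N := by
    rw [div_le_div_iff₀ hnk hn]; nlinarith
  have h1 : |k / (N - k) * M|
      ≤ 2 * k / N * ∑ i ∈ Finset.range (N - k), |a (x i) * b (x (i + k))| := by
    rw [abs_mul, abs_of_nonneg (by positivity)]
    exact mul_le_mul hkinv (Finset.abs_sum_le_sum_abs _ _) (abs_nonneg _) (by positivity)
  have h2 : |T| ≤ ∑ i ∈ Finset.Ico (N - k) N, |a (x i) * b (x (i + k))| :=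
    Finset.abs_sum_le_sum_abs _ _
  have h3 : |1 / (N - k) * (-(A * B') - B * A') + A * B / N|
      ≤ (2 * A ^ 2 + 2 * B ^ 2 + A' ^ 2 + B' ^ 2) / N := by
    have hq : |-(A * B') - B * A'| ≤ (A ^ 2 + B ^ 2 + A' ^ 2 + B' ^ 2) / 2 := by
      have h := abs_sub (-(A * B')) (B * A')
      rw [abs_neg] at h
      linarith [abs_mul_le_half_add_sq A B', abs_mul_le_half_add_sq B A']
    have hr : |A * B| ≤ A ^ 2 + B ^ 2 := by
      linarith [abs_mul_le_half_add_sq A B, sq_nonneg A, sq_nonneg B]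
    calc _ ≤ |1 / (N - k) * (-(A * B') - B * A')| + |A * B / N| := abs_add_le _ _
      _ = 1 / (N - k) * |-(A * B') - B * A'| + |A * B| / N := by
        rw [abs_mul, abs_div (A * B), abs_of_pos hn,
          abs_of_pos (by positivity : 0 < 1 / ((N : ℝ) - k))]
      _ ≤ 2 / N * ((A ^ 2 + B ^ 2 + A' ^ 2 + B' ^ 2) / 2) + (A ^ 2 + B ^ 2) / N := by
        gcongr
      _ = _ := by ring
  calc _ ≤ |k / (N - k) * M - T| + |1 / (N - k) * (-(A * B') - B * A') + A * B / N| :=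
        abs_add_le _ _
    _ ≤ |k / (N - k) * M| + |T| + |1 / (N - k) * (-(A * B') - B * A') + A * B / N| := by
      gcongr; exact abs_sub _ _
    _ ≤ _ := by gcongr

end Centring

/-! ### The centring error is negligible in mean -/

section Negligible

variable {Ω : Type*} [MeasurableSpace Ω] {P : Measure Ω} {μ : Measure ℝ}
  {X : ℕ → Ω → ℝ}

lemma integral_sq_sum_comp (hX : ∀ n, Measurable (X n)) (hindep : iIndepFun X P)
    (hlaw : ∀ n, HasLaw (X n) μ P) {u : ℝ → ℝ} (hu : Measurable u) (hu2 : MemLp u 2 μ)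
    (hu0 : ∫ x, u x ∂μ = 0) (k n : ℕ) :
    Integrable (fun ω => (∑ i ∈ Finset.range n, u (X (i + k) ω)) ^ 2) P ∧
    ∫ ω, (∑ i ∈ Finset.range n, u (X (i + k) ω)) ^ 2 ∂P = n * ∫ x, u x ^ 2 ∂μ := by
  have h2 : ∀ i, MemLp (fun ω => u (X (i + k) ω)) 2 P := fun i => (hlaw _).memLp_comp hu2
  refine ⟨(memLp_finsetSum _ fun i _ => h2 i).integrable_sq, ?_⟩
  have h := integral_sq_sum_of_orthogonal (v := ∫ x, u x ^ 2 ∂μ) h2 ?_ ?_ (Finset.range n)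
  · rwa [Finset.card_range] at h
  · intro i i' hne
    have hi : IndepFun (fun ω => u (X (i + k) ω)) (fun ω => u (X (i' + k) ω)) P :=
      (hindep.indepFun (show i + k ≠ i' + k by omega)).comp hu hu
    have h0 : ∫ ω, u (X (i + k) ω) ∂P = 0 := by
      rw [← hu0]
      exact (hlaw _).integral_comp hu.aestronglyMeasurable
    rw [hi.integral_fun_mul_eq_mul_integral (hu.comp (hX _)).aestronglyMeasurable
      (hu.comp (hX _)).aestronglyMeasurable, h0, zero_mul]
  · intro i
    exact (hlaw (i + k)).integral_comp (f := fun x => u x ^ 2) (hu.pow_const 2).aestronglyMeasurable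

lemma integral_abs_mul_lag_le
    (hlaw : ∀ n, HasLaw (X n) μ P) {a b : ℝ → ℝ} (ha : Measurable a) (hb : Measurable b)
    (ha2 : MemLp a 2 μ) (hb2 : MemLp b 2 μ) (n n' : ℕ) :
    ∫ ω, |a (X n ω) * b (X n' ω)| ∂P ≤ (∫ x, a x ^ 2 ∂μ) + ∫ x, b x ^ 2 ∂μ := by
  have hA := (hlaw n).memLp_comp ha2
  have hB := (hlaw n').memLp_comp hb2
  have h1 : ∫ ω, a (X n ω) ^ 2 ∂P = ∫ x, a x ^ 2 ∂μ :=
    (hlaw n).integral_comp (f := fun x => a x ^ 2) (ha.pow_const 2).aestronglyMeasurable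
  have h2 : ∫ ω, b (X n' ω) ^ 2 ∂P = ∫ x, b x ^ 2 ∂μ :=
    (hlaw n').integral_comp (f := fun x => b x ^ 2) (hb.pow_const 2).aestronglyMeasurable
  rw [← h1, ← h2, ← integral_add hA.integrable_sq hB.integrable_sq]
  refine integral_mono (hA.integrable_mul hB).abs
    (hA.integrable_sq.add hB.integrable_sq) fun ω => ?_
  dsimp only
  linarith [abs_mul_le_half_add_sq (a (X n ω)) (b (X n' ω)), sq_nonneg (a (X n ω)),
    sq_nonneg (b (X n' ω))]

/-- For centred `a` and `b`, `√N γ̂_k(a, b)` and the normalised sum of lag products are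
asymptotically equivalent in `L¹`: each term in the pathwise bound is `(√N)⁻¹` times a quantity of
bounded expectation. -/
lemma tendsto_integral_abs_sqrt_mul_empCrossCov_sub [IsProbabilityMeasure P]
    (hX : ∀ n, Measurable (X n))
    (hindep : iIndepFun X P) (hlaw : ∀ n, HasLaw (X n) μ P) {a b : ℝ → ℝ} (ha : Measurable a)
    (hb : Measurable b) (ha2 : MemLp a 2 μ) (hb2 : MemLp b 2 μ) (ha0 : ∫ x, a x ∂μ = 0)
    (hb0 : ∫ x, b x ∂μ = 0) (k : ℕ) :
    Tendsto (fun N : ℕ => ∫ ω, |√(N : ℝ) * empCrossCov (fun n => X n ω) a b k N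
        - (√(N : ℝ))⁻¹ * ∑ i ∈ Finset.range N, a (X i ω) * b (X (i + k) ω)| ∂P) atTop (𝓝 0) := by
  set va := ∫ x, a x ^ 2 ∂μ with hva
  set vb := ∫ x, b x ^ 2 ∂μ with hvb
  have hva0 : 0 ≤ va := integral_nonneg fun x => sq_nonneg _
  have hvb0 : 0 ≤ vb := integral_nonneg fun x => sq_nonneg _
  have hlim : Tendsto (fun N : ℕ => (√(N : ℝ))⁻¹ * (3 * k * (va + vb) + 3 * (va + vb))) atTop
      (𝓝 0) := by
    have h : Tendsto (fun N : ℕ => (√(N : ℝ))⁻¹) atTop (𝓝 0) :=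
      tendsto_inv_atTop_zero.comp (Real.tendsto_sqrt_atTop.comp tendsto_natCast_atTop_atTop)
    simpa using h.mul_const (3 * k * (va + vb) + 3 * (va + vb))
  refine squeeze_zero' (.of_forall fun N => integral_nonneg fun ω => abs_nonneg _) ?_ hlim
  filter_upwards [eventually_ge_atTop (2 * k), eventually_gt_atTop 0] with N hN hN0
  have hn : (0 : ℝ) < N := by exact_mod_cast hN0
  have hp : ∀ i, Integrable (fun ω => |a (X i ω) * b (X (i + k) ω)|) P :=
    fun i => (((hlaw i).memLp_comp ha2).integrable_mul ((hlaw _).memLp_comp hb2)).abs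
  obtain ⟨iA, eA⟩ := integral_sq_sum_comp hX hindep hlaw ha ha2 ha0 0 N
  obtain ⟨iB, eB⟩ := integral_sq_sum_comp hX hindep hlaw hb hb2 hb0 0 N
  obtain ⟨iA', eA'⟩ := integral_sq_sum_comp hX hindep hlaw ha ha2 ha0 0 (N - k)
  obtain ⟨iB', eB'⟩ := integral_sq_sum_comp hX hindep hlaw hb hb2 hb0 k (N - k)
  simp only [add_zero] at iA eA iB eB iA' eA'
  have iM : Integrable (fun ω => 2 * k / N *
      ∑ i ∈ Finset.range (N - k), |a (X i ω) * b (X (i + k) ω)|) P :=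
    (integrable_finsetSum _ fun i _ => hp i).const_mul _
  have iT : Integrable (fun ω => ∑ i ∈ Finset.Ico (N - k) N, |a (X i ω) * b (X (i + k) ω)|) P :=
    integrable_finsetSum _ fun i _ => hp i
  have iMT := iM.fun_add iT
  have iAB := (iA.const_mul 2).fun_add (iB.const_mul 2)
  have iABA := iAB.fun_add iA'
  have iQ := (iABA.fun_add iB').div_const (N : ℝ)
  refine (integral_mono_of_nonneg (ae_of_all _ fun ω => abs_nonneg _)
    ((iMT.fun_add iQ).const_mul ((√(N : ℝ))⁻¹)) (ae_of_all _ fun ω =>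
      abs_sqrt_mul_empCrossCov_sub_le (fun n => X n ω) a b hN hN0)).trans ?_
  rw [integral_const_mul, integral_add iMT iQ, integral_add iM iT, integral_const_mul,
    integral_finsetSum _ fun i _ => hp i, integral_finsetSum _ fun i _ => hp i, integral_div,
    integral_add iABA iB',
    integral_add iAB iA',
    integral_add (iA.const_mul 2) (iB.const_mul 2), integral_const_mul, integral_const_mul,
    eA, eB, eA', eB']
  refine mul_le_mul_of_nonneg_left (add_le_add ?_ ?_) (by positivity)
  · have hle : ∀ i, ∫ ω, |a (X i ω) * b (X (i + k) ω)| ∂P ≤ va + vb :=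
      fun i => integral_abs_mul_lag_le hlaw ha hb ha2 hb2 i (i + k)
    have h1 := Finset.sum_le_card_nsmul (Finset.range (N - k)) _ _ fun i _ => hle i
    have h2 := Finset.sum_le_card_nsmul (Finset.Ico (N - k) N) _ _ fun i _ => hle i
    rw [Finset.card_range, nsmul_eq_mul] at h1
    rw [Nat.card_Ico, Nat.sub_sub_self (by omega), nsmul_eq_mul] at h2
    have h3 : ((N - k : ℕ) : ℝ) * (va + vb) ≤ N * (va + vb) :=
      mul_le_mul_of_nonneg_right (by exact_mod_cast Nat.sub_le _ _) (by positivity)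
    calc _ ≤ 2 * k / N * (N * (va + vb)) + k * (va + vb) := by
          gcongr; exact h1.trans h3
      _ = _ := by field_simp; ring
  · rw [div_le_iff₀ hn]
    have hc : ((N - k : ℕ) : ℝ) ≤ N := by exact_mod_cast Nat.sub_le _ _
    nlinarith [mul_le_mul_of_nonneg_right hc hva0, mul_le_mul_of_nonneg_right hc hvb0]

end Negligible

/-! ### The limiting Gaussian law -/

lemma limitCovMat_eq_kronecker {m : ℕ} (μ : Measure ℝ) (f : Fin m → ℝ → ℝ) :
    limitCovMat μ f = covMat μ f ⊗ₖ covMat μ f := by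
  ext p q
  simp [limitCovMat, covMat, Matrix.kroneckerMap_apply]

/-- The quadratic form of the covariance matrix at `c` is the variance of `∑ i, c i * f i`. -/
lemma posSemidef_covMat {m : ℕ} {μ : Measure ℝ} [IsFiniteMeasure μ] {f : Fin m → ℝ → ℝ}
    (hf : ∀ i, MemLp (f i) 2 μ) : (covMat μ f).PosSemidef := by
  refine Matrix.PosSemidef.of_dotProduct_mulVec_nonneg ?_ fun c => ?_
  · ext i j
    simp [covMat, covariance_comm]
  · have h : star c ⬝ᵥ (covMat μ f).mulVec c = Var[fun x => ∑ i, c i * f i x; μ] := by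
      rw [← covariance_self (Finset.aemeasurable_fun_sum _ fun i _ =>
        (hf i).aemeasurable.const_mul _), covariance_fun_sum_fun_sum
          (fun i => (hf i).const_mul _) (fun i => (hf i).const_mul _)]
      simp only [covariance_const_mul_left, covariance_const_mul_right, dotProduct,
        Matrix.mulVec, covMat, Matrix.of_apply, Finset.mul_sum]
      refine Finset.sum_congr rfl fun i _ => Finset.sum_congr rfl fun j _ => ?_
      simp only [Pi.star_apply, star_trivial]
      ring
    rw [h]
    exact variance_nonneg _ _

lemma posSemidef_limitCovMat {m : ℕ} {μ : Measure ℝ} [IsFiniteMeasure μ] {f : Fin m → ℝ → ℝ}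
    (hf : ∀ i, MemLp (f i) 2 μ) : (limitCovMat μ f).PosSemidef := by
  rw [limitCovMat_eq_kronecker]
  exact (posSemidef_covMat hf).kronecker (posSemidef_covMat hf)

/-- The product measure is transported to `PiLp 2`, where characteristic functions are available;
`Fin K → _` itself carries the sup norm. -/
lemma charFun_pi_multivariateGaussian {ι κ : Type*} [Fintype ι] [Fintype κ] [DecidableEq κ]
    {S : Matrix κ κ ℝ} (hS : S.PosSemidef) (t : PiLp 2 fun _ : ι => EuclideanSpace ℝ κ) :
    charFun ((Measure.pi fun _ : ι => multivariateGaussian 0 S).map (WithLp.toLp 2)) t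
      = Complex.exp ((-(∑ k, ∑ p, ∑ q, t k p * t k q * S p q) / 2 : ℝ) : ℂ) := by
  rw [charFun_pi]
  simp_rw [charFun_multivariateGaussian hS, inner_zero_right]
  rw [← Complex.exp_sum]
  congr 1
  push_cast
  rw [← Finset.sum_neg_distrib, Finset.sum_div]
  refine Finset.sum_congr rfl fun k _ => ?_
  simp only [dotProduct, Matrix.mulVec, Finset.mul_sum]
  push_cast
  rw [zero_mul, zero_sub, neg_div]
  congr 2
  refine Finset.sum_congr rfl fun p _ => Finset.sum_congr rfl fun q _ => ?_
  ring

/-! ### Convergence of the empirical cross-covariances -/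

section LagProducts

variable {Ω : Type*} [MeasurableSpace Ω] {P : Measure Ω} {μ : Measure ℝ} {X : ℕ → Ω → ℝ}
  {m K : ℕ}

/-- The central limit theorem for an arbitrary linear combination of lag products, with the
coefficient vector `c` playing the role of the argument of a multivariate characteristic function. -/
lemma tendsto_charFun_sum_lag_products [IsProbabilityMeasure P]
    (hX : ∀ n, Measurable (X n)) (hindep : iIndepFun X P)
    (hlaw : ∀ n, HasLaw (X n) μ P) {a : Fin m → ℝ → ℝ} (ha : ∀ i, Measurable (a i))
    (ha4 : ∀ i, MemLp (a i) 4 μ) (ha0 : ∀ i, ∫ x, a i x ∂μ = 0)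
    (c : Fin K × (Fin m × Fin m) → ℝ) :
    Tendsto (fun N : ℕ => charFun (P.map fun ω => (√(N : ℝ))⁻¹ * ∑ n ∈ Finset.range N,
        ∑ i, c i * (a i.2.1 (X n ω) * a i.2.2 (X (n + (i.1 + 1)) ω))) 1) atTop
      (𝓝 (Complex.exp ((-(∑ k, ∑ p, ∑ q, c (k, p) * c (k, q) *
        ((∫ x, a p.1 x * a q.1 x ∂μ) * ∫ x, a p.2 x * a q.2 x ∂μ)) / 2 : ℝ) : ℂ))) := by
  let Y : ℕ → Ω → ℝ := fun n ω =>
    ∑ i, c i * (a i.2.1 (X n ω) * a i.2.2 (X (n + (i.1 + 1)) ω))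
  let y : (Fin (K + 1) → ℝ) → ℝ := fun w =>
    ∑ i : Fin K × (Fin m × Fin m), c i * (a i.2.1 (w 0) * a i.2.2 (w i.1.succ))
  have hy : Measurable y := by
    refine Finset.measurable_sum _ fun i _ => ?_
    have := ha i.2.1; have := ha i.2.2
    fun_prop
  have hZ2 : ∀ (i : Fin K × (Fin m × Fin m)) n,
      MemLp (fun ω => a i.2.1 (X n ω) * a i.2.2 (X (n + (i.1 + 1)) ω)) 2 P :=
    fun i n => memLp_mul_lag hlaw (ha4 _) (ha4 _) _ _
  have hY2 : ∀ n, MemLp (Y n) 2 P := fun n => memLp_finsetSum _ fun i _ => (hZ2 i n).const_mul _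
  have hZ0 : ∀ (i : Fin K × (Fin m × Fin m)) n,
      ∫ ω, a i.2.1 (X n ω) * a i.2.2 (X (n + (i.1 + 1)) ω) ∂P = 0 := by
    intro i n
    have hi : IndepFun (fun ω => a i.2.1 (X n ω)) (fun ω => a i.2.2 (X (n + (i.1 + 1)) ω)) P :=
      (hindep.indepFun (show n ≠ n + (i.1 + 1) by omega)).comp (ha _) (ha _)
    have h0 : ∫ ω, a i.2.1 (X n ω) ∂P = 0 := by
      rw [← ha0 i.2.1]
      exact (hlaw n).integral_comp (ha _).aestronglyMeasurable
    rw [hi.integral_fun_mul_eq_mul_integral ((ha _).comp (hX _)).aestronglyMeasurable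
      ((ha _).comp (hX _)).aestronglyMeasurable, h0, zero_mul]
  have hY0 : ∀ n, ∫ ω, Y n ω ∂P = 0 := by
    intro n
    simp only [Y]
    rw [integral_finsetSum _ fun i _ => ((hZ2 i n).const_mul _).integrable (by norm_num)]
    simp_rw [integral_const_mul, hZ0, mul_zero, Finset.sum_const_zero]
  have hYY : ∀ n n', ∫ ω, Y n ω * Y n' ω ∂P = ∑ i, ∑ j, c i * c j *
      if n = n' ∧ i.1 = j.1 then
        (∫ x, a i.2.1 x * a j.2.1 x ∂μ) * ∫ x, a i.2.2 x * a j.2.2 x ∂μ else 0 := by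
    intro n n'
    simp only [Y, Finset.sum_mul_sum]
    have hint : ∀ i j, Integrable (fun ω =>
        c i * (a i.2.1 (X n ω) * a i.2.2 (X (n + (i.1 + 1)) ω)) *
          (c j * (a j.2.1 (X n' ω) * a j.2.2 (X (n' + (j.1 + 1)) ω)))) P := fun i j =>
      ((hZ2 i n).const_mul (c i)).integrable_mul ((hZ2 j n').const_mul (c j))
    rw [integral_finsetSum _ fun i _ => integrable_finsetSum _ fun j _ => hint i j]
    refine Finset.sum_congr rfl fun i _ => ?_
    rw [integral_finsetSum _ fun j _ => hint i j]
    refine Finset.sum_congr rfl fun j _ => ?_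
    have h := integral_mul_lag_mul_lag hX hindep hlaw (ha i.2.1) (ha i.2.2) (ha j.2.1)
      (ha j.2.2) (ha0 _) (ha0 _) (ha0 _) (ha0 _) n n' i.1 j.1
    simp only [Fin.val_inj] at h
    rw [← h, ← integral_const_mul]
    congr with ω
    ring
  have h := tendsto_charFun_inv_sqrt_mul_sum_window hX hindep
    (fun n => (hlaw n).map_eq.trans (hlaw 0).map_eq.symm) hy (Y := Y)
    (v := ∑ k, ∑ p, ∑ q, c (k, p) * c (k, q) *
        ((∫ x, a p.1 x * a q.1 x ∂μ) * ∫ x, a p.2 x * a q.2 x ∂μ))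
    (fun n ω => by simp [Y, y]) hY2 hY0 ?_ ?_ 1
  · simpa [Y] using h
  · intro n n' hne
    simp [hYY, hne]
  · intro n
    simp_rw [sq, hYY]
    simp only [true_and, mul_ite, mul_zero, Fintype.sum_prod_type (α₁ := Fin K)]
    refine Finset.sum_congr rfl fun k _ => Finset.sum_congr rfl fun p _ => ?_
    rw [Finset.sum_eq_single_of_mem k (Finset.mem_univ _)]
    · simp
    · intro k' _ hne
      simp [hne.symm]

lemma measurable_empCrossCov (hX : ∀ n, Measurable (X n)) {f g : ℝ → ℝ} (hf : Measurable f)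
    (hg : Measurable g) (k N : ℕ) : Measurable fun ω => empCrossCov (fun n => X n ω) f g k N := by
  unfold empCrossCov empMean
  fun_prop

lemma integrable_empCrossCov (hlaw : ∀ n, HasLaw (X n) μ P) {f g : ℝ → ℝ} (hf : MemLp f 2 μ)
    (hg : MemLp g 2 μ) (k N : ℕ) :
    Integrable (fun ω => empCrossCov (fun n => X n ω) f g k N) P := by
  have hcomp : ∀ {u : ℝ → ℝ}, MemLp u 2 μ → ∀ n,
      MemLp (fun ω => u (X n ω) - empMean (fun n => X n ω) u N) 2 P := by
    intro u hu n
    exact ((hlaw n).memLp_comp hu).sub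
      ((memLp_finsetSum _ fun i _ => (hlaw i).memLp_comp hu).const_mul _)
  exact (integrable_finsetSum _ fun i _ =>
    (hcomp hf i).integrable_mul (hcomp hg (i + k))).const_mul _

lemma tendsto_charFun_sum_empCrossCov [IsProbabilityMeasure P]
    (hX : ∀ n, Measurable (X n)) (hindep : iIndepFun X P)
    (hlaw : ∀ n, HasLaw (X n) μ P) {f : Fin m → ℝ → ℝ} (hf : ∀ i, Measurable (f i))
    (hf4 : ∀ i, MemLp (f i) 4 μ) (c : Fin K × (Fin m × Fin m) → ℝ) :
    Tendsto (fun N : ℕ => charFun (P.map fun ω => ∑ i, c i *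
        (√(N : ℝ) * empCrossCov (fun n => X n ω) (f i.2.1) (f i.2.2) (i.1 + 1) N)) 1) atTop
      (𝓝 (Complex.exp ((-(∑ k, ∑ p, ∑ q, c (k, p) * c (k, q) * limitCovMat μ f p q) / 2 : ℝ)
        : ℂ))) := by
  have : IsProbabilityMeasure μ := by
    rw [← (hlaw 0).map_eq]
    exact Measure.isProbabilityMeasure_map (hlaw 0).aemeasurable
  let a : Fin m → ℝ → ℝ := fun i x => f i x - ∫ z, f i z ∂μ
  have ha : ∀ i, Measurable (a i) := fun i => (hf i).sub_const _
  have ha4 : ∀ i, MemLp (a i) 4 μ := fun i => (hf4 i).sub (memLp_const _)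
  have ha2 : ∀ i, MemLp (a i) 2 μ := fun i => (ha4 i).mono_exponent (by norm_num)
  have ha0 : ∀ i, ∫ x, a i x ∂μ = 0 := fun i => by
    simp only [a]
    rw [integral_sub ((hf4 i).integrable (by norm_num)) (integrable_const _)]
    simp
  -- Covariances are by definition the product moments of the centred functions.
  have hcov : ∀ p q, limitCovMat μ f p q
      = (∫ x, a p.1 x * a q.1 x ∂μ) * ∫ x, a p.2 x * a q.2 x ∂μ := fun p q => rfl
  simp_rw [hcov]
  have hmain := tendsto_charFun_sum_lag_products hX hindep hlaw ha ha4 ha0 c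
  refine tendsto_of_tendsto_of_dist hmain ?_
  have hd := fun i : Fin K × (Fin m × Fin m) =>
    (tendsto_integral_abs_sqrt_mul_empCrossCov_sub hX hindep hlaw (ha i.2.1) (ha i.2.2)
      (ha2 _) (ha2 _) (ha0 _) (ha0 _) (i.1 + 1)).const_mul |c i|
  have hsum := tendsto_finsetSum Finset.univ fun i _ => hd i
  simp only [mul_zero, Finset.sum_const_zero] at hsum
  refine squeeze_zero' (.of_forall fun N => dist_nonneg) ?_ hsum
  filter_upwards [eventually_ne_atTop 0] with N hN
  let Z : Fin K × (Fin m × Fin m) → Ω → ℝ := fun i ω =>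
    √(N : ℝ) * empCrossCov (fun n => X n ω) (a i.2.1) (a i.2.2) (i.1 + 1) N
  let W : Fin K × (Fin m × Fin m) → Ω → ℝ := fun i ω =>
    (√(N : ℝ))⁻¹ * ∑ n ∈ Finset.range N, a i.2.1 (X n ω) * a i.2.2 (X (n + (i.1 + 1)) ω)
  have hZi : ∀ i, Integrable (Z i) P := fun i =>
    (integrable_empCrossCov hlaw (ha2 _) (ha2 _) _ _).const_mul _
  have hWi : ∀ i, Integrable (W i) P := fun i => (integrable_finsetSum _ fun n _ =>
    (memLp_mul_lag hlaw (ha4 _) (ha4 _) _ _).integrable (by norm_num)).const_mul _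
  have hW : (fun ω => (√(N : ℝ))⁻¹ * ∑ n ∈ Finset.range N,
      ∑ i, c i * (a i.2.1 (X n ω) * a i.2.2 (X (n + (i.1 + 1)) ω)))
      = fun ω => ∑ i, c i * W i ω := by
    ext ω
    rw [Finset.sum_comm, Finset.mul_sum]
    refine Finset.sum_congr rfl fun i _ => ?_
    simp only [W, ← Finset.mul_sum]
    ring
  have hZ : (fun ω => ∑ i, c i *
      (√(N : ℝ) * empCrossCov (fun n => X n ω) (f i.2.1) (f i.2.2) (i.1 + 1) N))
      = fun ω => ∑ i, c i * Z i ω := by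
    ext ω
    simp only [Z, a, empCrossCov_sub_const _ _ _ _ _ _ hN]
  have hZW : ∀ i, Integrable (fun ω => |c i| * |Z i ω - W i ω|) P := fun i =>
    ((hZi i).sub (hWi i)).abs.const_mul _
  have hdiff : ∀ ω, |1 * (∑ i, c i * Z i ω) - 1 * ∑ i, c i * W i ω|
      ≤ ∑ i, |c i| * |Z i ω - W i ω| := by
    intro ω
    rw [one_mul, one_mul, ← Finset.sum_sub_distrib]
    refine (Finset.abs_sum_le_sum_abs _ _).trans_eq (Finset.sum_congr rfl fun i _ => ?_)
    rw [← mul_sub, abs_mul]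
  have hsZ : Integrable (fun ω => ∑ i, c i * Z i ω) P :=
    integrable_finsetSum _ fun i _ => (hZi i).const_mul _
  have hsW : Integrable (fun ω => ∑ i, c i * W i ω) P :=
    integrable_finsetSum _ fun i _ => (hWi i).const_mul _
  rw [dist_comm, dist_eq_norm, hW, hZ]
  calc _ ≤ ∫ ω, |1 * (∑ i, c i * Z i ω) - 1 * ∑ i, c i * W i ω| ∂P :=
        norm_charFun_map_sub_charFun_map_le hsZ.aemeasurable hsW.aemeasurable 1 1
          ((hsZ.const_mul 1).sub (hsW.const_mul 1))
    _ ≤ ∫ ω, ∑ i, |c i| * |Z i ω - W i ω| ∂P :=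
        integral_mono ((hsZ.const_mul 1).sub (hsW.const_mul 1)).abs
          (integrable_finsetSum _ fun i _ => hZW i) hdiff
    _ = ∑ i, |c i| * ∫ ω, |Z i ω - W i ω| ∂P := by
        rw [integral_finsetSum _ fun i _ => hZW i]
        simp_rw [integral_const_mul]

end LagProducts

theorem theorem1 {Ω : Type*} [MeasurableSpace Ω] (P : Measure Ω) [IsProbabilityMeasure P]
    (μ : Measure ℝ) (X : ℕ → Ω → ℝ)
    (hindep : iIndepFun X P) (hlaw : ∀ n, HasLaw (X n) μ P)
    (m : ℕ) (f : Fin m → ℝ → ℝ) (hf : ∀ i, Measurable (f i))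
    (hf4 : ∀ i, Integrable (fun x => f i x ^ 4) μ) (K : ℕ) :
    limitCovMat μ f = covMat μ f ⊗ₖ covMat μ f ∧
    (limitCovMat μ f).PosSemidef ∧
    TendstoInDistribution
      (fun (N : ℕ) (ω : Ω) (k : Fin K) =>
        Real.sqrt (N : ℝ) • empCrossCovVector (fun n => X n ω) f ((k : ℕ) + 1) N)
      atTop
      (fun ξ : Fin K → EuclideanSpace ℝ (Fin m × Fin m) => ξ)
      (fun _ => P)
      (Measure.pi fun _ : Fin K => multivariateGaussian 0 (limitCovMat μ f)) := by
  have : IsProbabilityMeasure μ := by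
    rw [← (hlaw 0).map_eq]
    exact Measure.isProbabilityMeasure_map (hlaw 0).aemeasurable
  have hf4' : ∀ i, MemLp (f i) 4 μ := fun i => by
    rw [← integrable_norm_rpow_iff (hf i).aestronglyMeasurable (by norm_num) (by norm_num)]
    refine (hf4 i).congr (ae_of_all _ fun x => ?_)
    simp only [Real.norm_eq_abs, ENNReal.toReal_ofNat]
    rw [← Even.pow_abs (by decide : Even 4)]
    exact_mod_cast (Real.rpow_natCast _ 4).symm
  have hS := posSemidef_limitCovMat fun i => (hf4' i).mono_exponent (p := 2) (by norm_num)
  refine ⟨limitCovMat_eq_kronecker μ f, hS, ?_⟩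
  -- The `X n` are only almost everywhere measurable; pass to measurable versions.
  let V : ℕ → Ω → ℝ := fun n => (hlaw n).aemeasurable.mk
  have hV : ∀ n, Measurable (V n) := fun n => (hlaw n).aemeasurable.measurable_mk
  have hXV : ∀ n, X n =ᵐ[P] V n := fun n => (hlaw n).aemeasurable.ae_eq_mk
  have hVlaw : ∀ n, HasLaw (V n) μ P := fun n => (hlaw n).congr (hXV n).symm
  have hVindep : iIndepFun V P := hindep.congr hXV
  let T : ℕ → Ω → PiLp 2 fun _ : Fin K => EuclideanSpace ℝ (Fin m × Fin m) := fun N ω =>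
    WithLp.toLp 2 fun k : Fin K =>
      Real.sqrt (N : ℝ) • empCrossCovVector (fun n => V n ω) f ((k : ℕ) + 1) N
  have hT : ∀ N, Measurable (T N) := fun N => by
    have h := fun i j k => measurable_empCrossCov hV (hf i) (hf j) k N
    simp only [T, empCrossCovVector]
    fun_prop
  have hconv : TendstoInDistribution T atTop
      (WithLp.toLp 2 : (Fin K → EuclideanSpace ℝ (Fin m × Fin m)) → _) (fun _ => P)
      (Measure.pi fun _ : Fin K => multivariateGaussian 0 (limitCovMat μ f)) := by
    refine ⟨fun N => (hT N).aemeasurable, by fun_prop, ?_⟩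
    refine ProbabilityMeasure.tendsto_iff_tendsto_charFun.2 fun t => ?_
    simp only [ProbabilityMeasure.coe_mk]
    rw [charFun_pi_multivariateGaussian hS]
    refine (tendsto_charFun_sum_empCrossCov hV hVindep hVlaw hf hf4'
      (fun i => t i.1 i.2)).congr fun N => ?_
    have h := fun i j k => measurable_empCrossCov hV (hf i) (hf j) k N
    rw [charFun_apply, charFun_apply, integral_map (hT N).aemeasurable (by fun_prop),
      integral_map (Measurable.aemeasurable (by fun_prop)) (by fun_prop)]
    congr with ω
    congr 3
    simp only [T, empCrossCovVector, PiLp.inner_apply, Fintype.sum_prod_type (α₁ := Fin K)]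
    simp
  have hfin := hconv.continuous_comp (g := WithLp.ofLp) (by fun_prop)
  refine hfin.congr (fun N => ?_) (by rfl)
  filter_upwards [ae_all_iff.2 hXV] with ω hω
  simp [T, hω]
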